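/- For a finite-dimensional complex Lie algebra $\mathfrak g$, let $\mu(\mathfrak g)$ denote the minimal dimension of a faithful linear representation of $\mathfrak g$, that is, the least $n\ge 0$ for which there is an injective homomorphism of Lie algebras $\mathfrak g\to\mathfrak{gl}_n(\mathbb C)$. For $m\in\mathbb Z$ let $\mathbb C^m$ be the abelian Lie algebra of dimension $m$ if $m\ge 0$, and the zero Lie algebra if $m<0$. **Theorem 1.4.** Let $\mathfrak g$ be a finite-dimensional complex reductive Lie algebra and let $$\mathfrak g=\mathfrak s_1\oplus\cdots\oplus\mathfrak s_\ell\oplus Z(\mathfrak g),\qquad Z(\mathfrak g)\cong\mathbb C^k,$$ be its decomposition into simple (non-abelian) ideals $\mathfrak s_i$ and center $Z(\mathfrak g)$, where $\ell,k\ge 0$. Then $\mathfrak g$ has a faithful finite-dimensional representation, and $$\mu(\mathfrak g)=\mu(\mathfrak s_1)+\cdots+\mu(\mathfrak s_\ell)+\mu(\mathbb C^{k-\ell}).$$ Moreover, $\mu(\mathbb C^m)=\lceil 2\sqrt{m-1}\,\rceil$ for every integer $m>1$, $\mu(\mathbb C)=1$, and $\mu(\mathbb C^m)=0$ for every integer $m\le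 0$. -/

import Mathlib

section

attribute [local instance 100] LieRing.ofAssociativeRing

/-- The set of all dimensions `n` of faithful finite-dimensional linear representations of the
Lie algebra `L` over the field `K`, i.e. those `n` for which there is an injective homomorphism
of Lie algebras `L → gl(Kⁿ)`. -/
def faithfulRepDims (K : Type*) [Field K] (L : Type*) [LieRing L] [LieAlgebra K L] : Set ℕ :=
  {n | ∃ φ : L →ₗ⁅K⁆ Module.End K (Fin n → K), Function.Injective φ}

/-- The invariant `μ(L)`: the minimal dimension of a faithful linear representation of `L`. -/
noncomputable def lieMu (K : Type*) [Field K] (L : Type*) [LieRing L] [LieAlgebra K L] : ℕ :=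
  sInf (faithfulRepDims K L)

/-- The Lie algebra `ℂⁿ` (coordinatewise commutator bracket) is abelian. -/
theorem isLieAbelian_complexPow (n : ℕ) : IsLieAbelian (Fin n → ℂ) :=
  ⟨fun x y => by ext i; simp [Ring.lie_def, mul_comm]⟩

/-- `μ(ℂᵐ)` for an integer `m`, where `ℂᵐ` is the abelian Lie algebra of dimension `m`, and is
read as the zero Lie algebra when `m ≤ 0`. -/
noncomputable def muComplexPow (m : ℤ) : ℕ :=
  lieMu ℂ (Fin m.toNat → ℂ)

end

/-- The Lie algebra `g` is the internal direct sum `s₁ ⊕ ⋯ ⊕ s_ℓ ⊕ Z(g)` of the simple ideals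
`sᵢ` and its center. -/
def IsReductiveDecomposition (g : Type*) [LieRing g] [LieAlgebra ℂ g] {ℓ : ℕ}
    (s : Fin ℓ → LieIdeal ℂ g) : Prop :=
  (∀ i, LieAlgebra.IsSimple ℂ (s i)) ∧
    DirectSum.IsInternal fun o : Option (Fin ℓ) =>
      (o.elim (LieAlgebra.center ℂ g) s : LieIdeal ℂ g).toSubmodule

/-! Write M(n) for `maxCommDim n`. By Schur's theorem on commuting matrices, an abelian Lie algebra
of dimension m embeds in gl_n exactly when m ≤ M(n); this gives μ(ℂ^m), and the ceiling formula
comes from solving ⌊n²/4⌋ + 1 ≥ m for n.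

For the upper bound, add minimal faithful representations of the simple ideals. Each block leaves
its scalars free, so ℓ dimensions of the center act at no cost, and only the remaining k - ℓ need an
extra block.

For the lower bound, let 𝔤 act faithfully on V. It suffices that dim V = ∑ μ(𝔰ᵢ) + b with k ≤ ℓ +
M(b); this is `CommutingBound`. Let R be the centralizer of the image of the center, so that R
contains the image of 𝔤 and the center becomes a commuting space in End_R(V). If V ≅ Uⁿ with U
simple, then End_R(V) is the algebra of n × n matrices, Schur bounds the commuting space by M(n),
and `sum_lieMu_le_of_commute` gives dim U ≥ ∑ μ(𝔰ᵢ) over the ideals acting nontrivially.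
Superadditivity of M glues isotypic components. If V is not semisimple, it is replaced by N × V/N
with N the socle: the commuting space survives with the same dimension
(`exists_commuting_prod_quotient`), and the socle grows until the module is semisimple. -/

section

/-! ### The function ⌊n²/4⌋ + 1 -/

open Module

/-- The maximal dimension of a commuting space of endomorphisms of an `n`-dimensional space. -/
def maxCommDim (n : ℕ) : ℕ := if n = 0 then 0 else n ^ 2 / 4 + 1

theorem maxCommDim_of_pos {n : ℕ} (hn : 0 < n) : maxCommDim n = n ^ 2 / 4 + 1 :=
  if_neg hn.ne'

@[simp] theorem maxCommDim_zero : maxCommDim 0 = 0 := rfl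

/-- For positive a and b the cross term ab/2 in (a + b)²/4 pays for the second summand 1; the parity
cases handle the floors. The value 0 at n = 0 is what keeps the inequality true when a or b
vanishes. -/
theorem maxCommDim_add (a b : ℕ) : maxCommDim a + maxCommDim b ≤ maxCommDim (a + b) := by
  rcases Nat.eq_zero_or_pos a with rfl | ha
  · simp
  rcases Nat.eq_zero_or_pos b with rfl | hb
  · simp
  rw [maxCommDim_of_pos ha, maxCommDim_of_pos hb, maxCommDim_of_pos (by omega)]
  have key : a ^ 2 / 4 + b ^ 2 / 4 + 1 ≤ (a + b) ^ 2 / 4 := by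
    rw [Nat.le_div_iff_mul_le (by norm_num)]
    obtain ⟨p, rfl | rfl⟩ := Nat.even_or_odd' a <;> obtain ⟨q, rfl | rfl⟩ := Nat.even_or_odd' b
    · rw [show (2 * p) ^ 2 = 4 * p ^ 2 by ring, show (2 * q) ^ 2 = 4 * q ^ 2 by ring,
        Nat.mul_div_cancel_left _ (by norm_num), Nat.mul_div_cancel_left _ (by norm_num)]
      have : 1 ≤ p * q := Nat.mul_pos (by omega) (by omega)
      nlinarith
    · rw [show (2 * p) ^ 2 = 4 * p ^ 2 by ring,
        show (2 * q + 1) ^ 2 = 1 + 4 * (q ^ 2 + q) by ring, Nat.mul_div_cancel_left _ (by norm_num),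
        Nat.add_mul_div_left _ _ (by norm_num)]
      have : 1 ≤ p := by omega
      norm_num
      nlinarith [Nat.zero_le (p * q)]
    · rw [show (2 * q) ^ 2 = 4 * q ^ 2 by ring,
        show (2 * p + 1) ^ 2 = 1 + 4 * (p ^ 2 + p) by ring, Nat.mul_div_cancel_left _ (by norm_num),
        Nat.add_mul_div_left _ _ (by norm_num)]
      have : 1 ≤ q := by omega
      norm_num
      nlinarith [Nat.zero_le (p * q)]
    · rw [show (2 * q + 1) ^ 2 = 1 + 4 * (q ^ 2 + q) by ring,
        show (2 * p + 1) ^ 2 = 1 + 4 * (p ^ 2 + p) by ring,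
        Nat.add_mul_div_left _ _ (by norm_num), Nat.add_mul_div_left _ _ (by norm_num)]
      norm_num
      nlinarith [Nat.zero_le (p * q)]
  omega

theorem maxCommDim_mono : Monotone maxCommDim := fun a b h ↦ by
  obtain ⟨c, rfl⟩ := Nat.exists_eq_add_of_le h
  exact le_trans (Nat.le_add_right _ _) (maxCommDim_add a c)

theorem le_maxCommDim (n : ℕ) : n ≤ maxCommDim n := by
  induction n with
  | zero => simp
  | succ n ih => have := maxCommDim_add n 1; rw [show maxCommDim 1 = 1 from rfl] at this; omega

/-- Used for m + 1 copies of a simple module of dimension d: one copy is given up to the simple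
ideals, the other d * m dimensions still accommodate all but one dimension of the commuting space.
-/
theorem maxCommDim_le_succ (d m : ℕ) (hd : 2 ≤ d) :
    maxCommDim (m + 1) ≤ 1 + maxCommDim (d * m) := by
  refine le_trans ?_ (Nat.add_le_add_left (maxCommDim_mono (Nat.mul_le_mul_right m hd)) 1)
  rcases Nat.eq_zero_or_pos m with rfl | hm
  · rfl
  rw [maxCommDim_of_pos (by omega), maxCommDim_of_pos (by omega)]
  have : (m + 1) ^ 2 / 4 ≤ (2 * m) ^ 2 / 4 := Nat.div_le_div_right (by gcongr; omega)
  omega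

/-! ### Schur's bound for commuting spaces of endomorphisms -/

section CommonEigenvector

variable {V : Type*} [AddCommGroup V] [Module ℂ V] [FiniteDimensional ℂ V]

/-- Schur's lemma for finite-dimensional modules over a complex algebra. -/
theorem exists_eq_smul_of_isSimpleModule {R : Type*} [Ring R] [Algebra ℂ R] [Module R V]
    [IsScalarTower ℂ R V] [IsSimpleModule R V] (f : Module.End R V) :
    ∃ c : ℂ, f = algebraMap ℂ (Module.End R V) c := by
  have : Nontrivial V := IsSimpleModule.nontrivial R V
  obtain ⟨c, hc⟩ := Module.End.exists_eigenvalue (f.restrictScalars ℂ : Module.End ℂ V)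
  obtain ⟨v, hv⟩ := hc.exists_hasEigenvector
  refine ⟨c, ?_⟩
  rcases LinearMap.injective_or_eq_zero (f - algebraMap ℂ (Module.End R V) c) with h | h
  · refine absurd (h (a₁ := v) (a₂ := 0) ?_) hv.2
    have h1 : f v = c • v := hv.apply_eq_smul
    simp [h1, Module.algebraMap_end_apply]
  · exact sub_eq_zero.mp h

/-- Take a simple submodule over the algebra generated by `s`. Elements of `s` commute with that
algebra, so they act on the submodule by scalars, by Schur's lemma. -/
theorem exists_common_eigenvector [Nontrivial V] (s : Set (Module.End ℂ V))
    (hs : ∀ x ∈ s, ∀ y ∈ s, x * y = y * x) :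
    ∃ v : V, v ≠ 0 ∧ ∀ x ∈ s, ∃ c : ℂ, x v = c • v := by
  let B := Algebra.adjoin ℂ s
  have : IsArtinian B V := isArtinian_of_tower ℂ inferInstance
  obtain ⟨W, hW⟩ := IsAtomic.exists_atom (Submodule B V)
  have hW' : IsSimpleModule B W := isSimpleModule_iff_isAtom.mpr hW
  have : FiniteDimensional ℂ W := FiniteDimensional.finiteDimensional_submodule
    (W.restrictScalars ℂ)
  have : Nontrivial W := IsSimpleModule.nontrivial B W
  obtain ⟨w, hw⟩ := exists_ne (0 : W)
  refine ⟨w, by simpa using hw, fun x hx ↦ ?_⟩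
  have hcomm : ∀ b : B, x * b = b * x := fun b ↦ by
    have h : (b : Module.End ℂ V) ∈ Subalgebra.centralizer ℂ s :=
      (Algebra.adjoin_le fun y hy ↦ by
        rw [SetLike.mem_coe, Subalgebra.mem_centralizer_iff]
        exact fun z hz ↦ hs z hz y hy) b.2
    exact (Subalgebra.mem_centralizer_iff ℂ).mp h x hx
  let f : Module.End B W :=
    { toFun := fun u ↦ ⟨x u, W.smul_mem ⟨x, Algebra.subset_adjoin hx⟩ u.2⟩
      map_add' := fun u v ↦ by ext; simp
      map_smul' := fun b u ↦ by
        ext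
        exact LinearMap.congr_fun (hcomm b) u }
  obtain ⟨c, hc⟩ := exists_eq_smul_of_isSimpleModule (R := B) (V := W) f
  exact ⟨c, congrArg Subtype.val (LinearMap.congr_fun hc w)⟩

end CommonEigenvector

/-- Induction through an invariant hyperplane N and an invariant line W inside it. Restriction to N
and passage to V/W each have image bounded by the case n, and since their kernels annihilate each
other, the dimensions of the kernels add up to at most n + 1. -/
theorem finrank_le_maxCommDim_of_commute {n : ℕ} : ∀ {V : Type*} [AddCommGroup V] [Module ℂ V]
    [FiniteDimensional ℂ V] (Z : Submodule ℂ (Module.End ℂ V))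
    (_ : ∀ x ∈ Z, ∀ y ∈ Z, x * y = y * x), finrank ℂ V = n → finrank ℂ Z ≤ maxCommDim n := by
  induction n with
  | zero =>
    intro V _ _ _ Z _ hV
    have := Submodule.finrank_le Z
    rw [finrank_linearMap, hV] at this
    simpa using this
  | succ n ih =>
    intro V _ _ _ Z hZ hV
    rcases Nat.eq_zero_or_pos n with rfl | hn
    · have := Submodule.finrank_le Z
      rw [finrank_linearMap, hV] at this
      simpa [maxCommDim] using this
    have : Nontrivial V := Module.nontrivial_of_finrank_pos (R := ℂ) (by omega)
    -- a common eigenvector of the transposed family: an invariant hyperplane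
    obtain ⟨φ, hφ0, hφ⟩ := exists_common_eigenvector (V := Module.Dual ℂ V)
      ((fun x : Module.End ℂ V ↦ (LinearMap.dualMap x : Module.End ℂ (Module.Dual ℂ V))) '' Z) (by
        rintro _ ⟨x, hx, rfl⟩ _ ⟨y, hy, rfl⟩
        have := hZ x hx y hy
        ext ψ v
        simpa using congrArg ψ (LinearMap.congr_fun this.symm v))
    have hφZ : ∀ x ∈ Z, ∃ c : ℂ, ∀ v, φ (x v) = c * φ v := fun x hx ↦ by
      obtain ⟨c, hc⟩ := hφ _ ⟨x, hx, rfl⟩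
      exact ⟨c, fun v ↦ by simpa using LinearMap.congr_fun hc v⟩
    set N : Submodule ℂ V := LinearMap.ker φ with hN
    have hNZ : ∀ x ∈ Z, ∀ v ∈ N, x v ∈ N := fun x hx v hv ↦ by
      obtain ⟨c, hc⟩ := hφZ x hx
      rw [hN, LinearMap.mem_ker] at hv ⊢
      rw [hc, hv, mul_zero]
    have hNrank : finrank ℂ N = n := by
      have := Module.Dual.finrank_ker_add_one_of_ne_zero hφ0
      rw [← hN] at this
      omega
    let resN : Z →ₗ[ℂ] Module.End ℂ N :=
      { toFun := fun z ↦ (z : Module.End ℂ V).restrict (hNZ z z.2)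
        map_add' := fun _ _ ↦ rfl
        map_smul' := fun _ _ ↦ rfl }
    have hresN : ∀ x ∈ LinearMap.range resN, ∀ y ∈ LinearMap.range resN, x * y = y * x := by
      rintro _ ⟨x, rfl⟩ _ ⟨y, rfl⟩
      ext v
      exact LinearMap.congr_fun (hZ x x.2 y y.2) v
    have : Nontrivial N := Module.nontrivial_of_finrank_pos (R := ℂ) (by omega)
    -- The line is taken inside N so that operators vanishing on N also kill W.
    obtain ⟨w, hw0, hw⟩ := exists_common_eigenvector (LinearMap.range resN : Set (Module.End ℂ N))
      hresN
    set W : Submodule ℂ V := ℂ ∙ (w : V) with hWdef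
    have hw0' : (w : V) ≠ 0 := by simpa using hw0
    have hWN : W ≤ N := (Submodule.span_singleton_le_iff_mem _ _).mpr w.2
    have hWZ : ∀ x ∈ Z, W ≤ W.comap x := fun x hx ↦ by
      obtain ⟨c, hc⟩ := hw _ ⟨⟨x, hx⟩, rfl⟩
      rw [hWdef, Submodule.span_singleton_le_iff_mem, Submodule.mem_comap,
        Submodule.mem_span_singleton]
      exact ⟨c, (congrArg Subtype.val hc).symm⟩
    have hWrank : finrank ℂ W = 1 := finrank_span_singleton hw0'
    have hQrank : finrank ℂ (V ⧸ W) = n := by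
      have := Submodule.finrank_quotient_add_finrank W
      omega
    let resQ : Z →ₗ[ℂ] Module.End ℂ (V ⧸ W) :=
      { toFun := fun z ↦ W.mapQ W (z : Module.End ℂ V) (hWZ z z.2)
        map_add' := fun _ _ ↦ by ext; rfl
        map_smul' := fun _ _ ↦ by ext; rfl }
    have hresQ : ∀ x ∈ LinearMap.range resQ, ∀ y ∈ LinearMap.range resQ, x * y = y * x := by
      rintro _ ⟨x, rfl⟩ _ ⟨y, rfl⟩
      ext v
      exact congrArg W.mkQ (LinearMap.congr_fun (hZ x x.2 y y.2) v)
    have h1 := LinearMap.finrank_range_add_finrank_ker resN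
    have h2 := LinearMap.finrank_range_add_finrank_ker resQ
    have h3 := ih (LinearMap.range resN) hresN hNrank
    have h4 := ih (LinearMap.range resQ) hresQ hQrank
    -- the two kernels annihilate each other
    obtain ⟨v₀, hv₀⟩ : ∃ v, φ v = 1 := LinearMap.surjective hφ0 1
    let ev : LinearMap.ker resN →ₗ[ℂ] V :=
      { toFun := fun f ↦ (f : Z).1 v₀
        map_add' := fun _ _ ↦ rfl
        map_smul' := fun _ _ ↦ rfl }
    have hF : ∀ f : LinearMap.ker resN, ∀ v ∈ N, (f : Z).1 v = 0 := fun f v hv ↦ by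
      have := LinearMap.congr_fun (LinearMap.mem_ker.mp f.2) (⟨v, hv⟩ : N)
      exact congrArg Subtype.val this
    have hev : Function.Injective ev := by
      rw [injective_iff_map_eq_zero]
      intro f hf
      have hf' : (f : Z).1 v₀ = 0 := hf
      ext v
      have hv : v - φ v • v₀ ∈ N := by simp [hN, hv₀]
      have := hF f _ hv
      rw [map_sub, map_smul, hf', smul_zero, sub_zero] at this
      simpa using this
    have hE : ∀ e : LinearMap.ker resQ, ∀ v, (e : Z).1 v ∈ W := fun e v ↦ by
      have := LinearMap.congr_fun (LinearMap.mem_ker.mp e.2) (W.mkQ v)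
      exact (Submodule.Quotient.mk_eq_zero W).mp this
    set P := LinearMap.range ev with hP
    have hEP : ∀ e : LinearMap.ker resQ, P ≤ LinearMap.ker ((e : Z).1) := by
      rintro e _ ⟨f, rfl⟩
      have h5 := LinearMap.congr_fun (hZ (e : Z) (e : Z).2 (f : Z) (f : Z).2) v₀
      have h6 : (f : Z).1 ((e : Z).1 v₀) = 0 := hF f _ (hWN (hE e v₀))
      exact h5.trans h6
    let quot : LinearMap.ker resQ →ₗ[ℂ] ((V ⧸ P) →ₗ[ℂ] W) :=
      { toFun := fun e ↦ P.liftQ ((e : Z).1.codRestrict W (hE e)) (by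
          rw [LinearMap.ker_codRestrict]; exact hEP e)
        map_add' := fun _ _ ↦ by ext; rfl
        map_smul' := fun _ _ ↦ by ext; rfl }
    have hquot : Function.Injective quot := by
      rw [injective_iff_map_eq_zero]
      intro e he
      ext v
      exact congrArg Subtype.val (LinearMap.congr_fun he (P.mkQ v))
    have h7 := LinearMap.finrank_le_finrank_of_injective hquot
    rw [finrank_linearMap, hWrank, mul_one] at h7
    have h8 := Submodule.finrank_quotient_add_finrank P
    have h9 : finrank ℂ P = finrank ℂ (LinearMap.ker resN) := LinearMap.finrank_range_of_inj hev
    rw [maxCommDim_of_pos hn] at h3 h4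
    rw [maxCommDim_of_pos (by omega)]
    -- The smaller of the two kernels has dimension at most ⌊(n + 1)/2⌋, exactly the increment of
    -- ⌊n²/4⌋.
    have h10 : n ^ 2 / 4 + (n + 1) / 2 = (n + 1) ^ 2 / 4 := by
      obtain ⟨p, rfl | rfl⟩ := Nat.even_or_odd' n
      · rw [show (2 * p) ^ 2 = 4 * p ^ 2 by ring,
          show (2 * p + 1) ^ 2 = 1 + 4 * (p ^ 2 + p) by ring,
          Nat.mul_div_cancel_left _ (by norm_num), Nat.add_mul_div_left _ _ (by norm_num)]
        omega
      · rw [show (2 * p + 1 + 1) ^ 2 = 4 * (p ^ 2 + 2 * p + 1) by ring,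
          show (2 * p + 1) ^ 2 = 1 + 4 * (p ^ 2 + p) by ring,
          Nat.mul_div_cancel_left _ (by norm_num), Nat.add_mul_div_left _ _ (by norm_num)]
        omega
    omega

end

/-! ### Faithful representations and the invariant μ -/

section

open Module

attribute [local instance 100] LieRing.ofAssociativeRing

section FaithfulRepresentations

variable {L : Type*} [LieRing L] [LieAlgebra ℂ L]

theorem finrank_mem_faithfulRepDims {V : Type*} [AddCommGroup V] [Module ℂ V]
    [FiniteDimensional ℂ V] (ρ : L →ₗ⁅ℂ⁆ Module.End ℂ V) (hρ : Function.Injective ρ) :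
    finrank ℂ V ∈ faithfulRepDims ℂ L := by
  let e : V ≃ₗ[ℂ] (Fin (finrank ℂ V) → ℂ) := (finBasis ℂ V).equivFun
  exact ⟨e.lieConj.toLieHom.comp ρ, e.lieConj.injective.comp hρ⟩

theorem lieMu_mem_faithfulRepDims (h : (faithfulRepDims ℂ L).Nonempty) :
    lieMu ℂ L ∈ faithfulRepDims ℂ L :=
  Nat.sInf_mem h

theorem lieMu_le_finrank {V : Type*} [AddCommGroup V] [Module ℂ V]
    [FiniteDimensional ℂ V] (ρ : L →ₗ⁅ℂ⁆ Module.End ℂ V) (hρ : Function.Injective ρ) :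
    lieMu ℂ L ≤ finrank ℂ V :=
  Nat.sInf_le (finrank_mem_faithfulRepDims ρ hρ)

/-- Matrices of size at most one commute. The bound 2 is what later lets products of dimensions
dominate sums. -/
theorem two_le_of_mem_faithfulRepDims (hL : ¬ IsLieAbelian L) {n : ℕ}
    (hn : n ∈ faithfulRepDims ℂ L) : 2 ≤ n := by
  obtain ⟨ρ, hρ⟩ := hn
  by_contra! hlt
  have : Subsingleton (Fin n) := Fin.subsingleton_iff_le_one.mpr (by omega)
  refine hL ⟨fun x y ↦ hρ ?_⟩
  rw [LieHom.map_lie, map_zero, LieRing.of_associative_ring_bracket, sub_eq_zero]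
  apply (LinearMap.toMatrixAlgEquiv' (R := ℂ) (n := Fin n)).injective
  rw [map_mul, map_mul]
  ext i j
  simp [Matrix.mul_apply, Subsingleton.elim j i, Fintype.sum_subsingleton _ i, mul_comm]

theorem two_le_lieMu (hL : ¬ IsLieAbelian L) (h : (faithfulRepDims ℂ L).Nonempty) :
    2 ≤ lieMu ℂ L :=
  two_le_of_mem_faithfulRepDims hL (lieMu_mem_faithfulRepDims h)

theorem LieAlgebra.IsSimple.injective_of_ne_zero [LieAlgebra.IsSimple ℂ L] {L' : Type*}
    [LieRing L'] [LieAlgebra ℂ L'] {ρ : L →ₗ⁅ℂ⁆ L'} (hρ : ρ ≠ 0) : Function.Injective ρ := by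
  rcases LieAlgebra.IsSimple.eq_bot_or_eq_top (R := ℂ) ρ.ker with h | h
  · exact ρ.ker_eq_bot.mp h
  · refine absurd ?_ hρ
    ext x
    have : x ∈ ρ.ker := h ▸ LieSubmodule.mem_top x
    exact LieHom.mem_ker.mp this

theorem LieAlgebra.IsSimple.faithfulRepDims_nonempty [LieAlgebra.IsSimple ℂ L]
    [FiniteDimensional ℂ L] : (faithfulRepDims ℂ L).Nonempty :=
  ⟨_, finrank_mem_faithfulRepDims (LieAlgebra.ad ℂ L)
    (LieAlgebra.IsSimple.injective_of_ne_zero fun h ↦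
      LieAlgebra.IsSimple.non_abelian ℂ (L := L) ⟨fun x y ↦ by
        have := LinearMap.congr_fun (LieHom.congr_fun h x) y
        simpa using this⟩)⟩

end FaithfulRepresentations

/-! ### Abelian Lie algebras -/

section Abelian

/-- Block matrices with equal scalars on the diagonal and an arbitrary a × b block above it commute;
balancing a + b = n gives ab = ⌊n²/4⌋, and the scalars add one. -/
theorem exists_injective_commuting {n m : ℕ} (h : m ≤ maxCommDim n) :
    ∃ θ : (Fin m → ℂ) →ₗ[ℂ] Module.End ℂ (Fin n → ℂ), Function.Injective θ ∧
      ∀ x y, θ x * θ y = θ y * θ x := by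
  rcases Nat.eq_zero_or_pos n with rfl | hn
  · obtain rfl : m = 0 := by simpa using h
    exact ⟨0, Function.injective_of_subsingleton _, fun _ _ ↦ by simp⟩
  rw [maxCommDim_of_pos hn] at h
  obtain ⟨a, b, rfl, hab⟩ : ∃ a b, a + b = n ∧ a * b = n ^ 2 / 4 := by
    obtain ⟨p, rfl | rfl⟩ := Nat.even_or_odd' n
    · refine ⟨p, p, by omega, ?_⟩
      rw [show (2 * p) ^ 2 = 4 * p ^ 2 by ring, Nat.mul_div_cancel_left _ (by norm_num), sq]
    · refine ⟨p, p + 1, by omega, ?_⟩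
      rw [show (2 * p + 1) ^ 2 = 1 + 4 * (p ^ 2 + p) by ring,
        Nat.add_mul_div_left _ _ (by norm_num)]
      norm_num
      ring
  let B : ℂ × Matrix (Fin a) (Fin b) ℂ →ₗ[ℂ] Matrix (Fin a ⊕ Fin b) (Fin a ⊕ Fin b) ℂ :=
    { toFun := fun x ↦ Matrix.fromBlocks (x.1 • 1) x.2 0 (x.1 • 1)
      map_add' := fun x y ↦ by simp [Matrix.fromBlocks_add, add_smul]
      map_smul' := fun c x ↦ by simp [Matrix.fromBlocks_smul, mul_smul] }
  have hBinj : Function.Injective B := fun x y hxy ↦ by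
    obtain ⟨h1, h2, -, h4⟩ := Matrix.fromBlocks_inj.mp hxy
    refine Prod.ext ?_ h2
    -- For n = 1 the first diagonal block is empty, and the scalar has to be read off the second.
    rcases Nat.eq_zero_or_pos a with rfl | ha
    · have := congrFun (congrFun h4 ⟨0, by omega⟩) ⟨0, by omega⟩
      simpa using this
    · have := congrFun (congrFun h1 ⟨0, ha⟩) ⟨0, ha⟩
      simpa using this
  have hBcomm : ∀ x y, B x * B y = B y * B x := fun x y ↦ by
    change Matrix.fromBlocks _ _ _ _ * Matrix.fromBlocks _ _ _ _ =
      Matrix.fromBlocks _ _ _ _ * Matrix.fromBlocks _ _ _ _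
    simp [Matrix.fromBlocks_multiply, smul_smul, mul_comm, add_comm]
  obtain ⟨ι, hι⟩ := (finrank_le_iff_exists_linearMap (R := ℂ) (M := Fin m → ℂ) 
    (M' := ℂ × Matrix (Fin a) (Fin b) ℂ)).mp (by
    simp only [finrank_prod, finrank_matrix, finrank_self, finrank_fin_fun, Fintype.card_fin]
    omega)
  let e : Matrix (Fin a ⊕ Fin b) (Fin a ⊕ Fin b) ℂ ≃ₐ[ℂ] Module.End ℂ (Fin (a + b) → ℂ) :=
    (Matrix.reindexAlgEquiv ℂ ℂ finSumFinEquiv).trans Matrix.toLinAlgEquiv'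
  refine ⟨e.toLinearMap ∘ₗ B ∘ₗ ι, e.injective.comp (hBinj.comp hι), fun x y ↦ ?_⟩
  simpa using congrArg e (hBcomm (ι x) (ι y))

theorem mem_faithfulRepDims_iff_of_isLieAbelian {L : Type*} [LieRing L] [LieAlgebra ℂ L]
    [FiniteDimensional ℂ L] [IsLieAbelian L] {n : ℕ} :
    n ∈ faithfulRepDims ℂ L ↔ finrank ℂ L ≤ maxCommDim n := by
  constructor
  · rintro ⟨ρ, hρ⟩
    have hle := finrank_le_maxCommDim_of_commute (n := n)
      (LinearMap.range (ρ : L →ₗ[ℂ] Module.End ℂ (Fin n → ℂ))) (by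
        rintro _ ⟨x, rfl⟩ _ ⟨y, rfl⟩
        have : ρ ⁅x, y⁆ = 0 := by rw [trivial_lie_zero, map_zero]
        rwa [LieHom.map_lie, LieRing.of_associative_ring_bracket, sub_eq_zero] at this) (by simp)
    rwa [LinearMap.finrank_range_of_inj hρ] at hle
  · intro h
    obtain ⟨θ, hθ, hcomm⟩ := exists_injective_commuting h
    let e := (finBasis ℂ L).equivFun
    refine ⟨{ θ ∘ₗ e.toLinearMap with
      map_lie' := fun {x y} ↦ ?_ }, hθ.comp e.injective⟩
    simp [LieRing.of_associative_ring_bracket, trivial_lie_zero, hcomm (e x) (e y)]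

theorem muComplexPow_eq_sInf (m : ℤ) : muComplexPow m = sInf {n | m.toNat ≤ maxCommDim n} := by
  have := isLieAbelian_complexPow m.toNat
  unfold muComplexPow lieMu
  congr 1
  ext n
  rw [mem_faithfulRepDims_iff_of_isLieAbelian, finrank_fin_fun, Set.mem_ofPred_eq]

theorem muComplexPow_le_iff (m : ℤ) (n : ℕ) : muComplexPow m ≤ n ↔ m.toNat ≤ maxCommDim n := by
  rw [muComplexPow_eq_sInf]
  refine ⟨fun h ↦ ?_, fun h ↦ Nat.sInf_le h⟩
  have : sInf {n | m.toNat ≤ maxCommDim n} ∈ {n | m.toNat ≤ maxCommDim n} :=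
    Nat.sInf_mem ⟨_, le_maxCommDim m.toNat⟩
  exact le_trans this (maxCommDim_mono h)

theorem muComplexPow_of_nonpos {m : ℤ} (hm : m ≤ 0) : muComplexPow m = 0 := by
  rw [← Nat.le_zero, muComplexPow_le_iff, Int.toNat_of_nonpos hm]
  exact Nat.zero_le _

theorem muComplexPow_one : muComplexPow 1 = 1 := by
  apply le_antisymm
  · rw [muComplexPow_le_iff]; decide
  · rw [Nat.one_le_iff_ne_zero, ← Nat.pos_iff_ne_zero, ← not_le, muComplexPow_le_iff]
    decide

/-- With m = k + 1, both sides are at most n exactly when 4k ≤ n². The case n = 0 is separate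
because `maxCommDim` breaks its formula there; both conditions then fail since k > 0. -/
theorem muComplexPow_eq_ceil {m : ℤ} (hm : 1 < m) :
    (muComplexPow m : ℤ) = ⌈2 * √((m : ℝ) - 1)⌉ := by
  obtain ⟨k, rfl⟩ : ∃ k : ℕ, m = (k : ℤ) + 1 := ⟨(m - 1).toNat, by omega⟩
  have hk : 0 < k := by omega
  rw [Int.cast_add, Int.cast_natCast, Int.cast_one, add_sub_cancel_right]
  have hpos : 0 ≤ ⌈2 * √(k : ℝ)⌉ := Int.ceil_nonneg (by positivity)
  have key : ∀ n : ℕ, muComplexPow (k + 1) ≤ n ↔ ⌈2 * √(k : ℝ)⌉ ≤ n := fun n ↦ by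
    rw [muComplexPow_le_iff, Int.ceil_le, Int.cast_natCast,
      show ((k : ℤ) + 1).toNat = k + 1 by omega]
    have h1 : 2 * √(k : ℝ) ≤ n ↔ 4 * k ≤ n ^ 2 := by
      rw [← abs_of_nonneg (show (0 : ℝ) ≤ 2 * √k by positivity),
        ← abs_of_nonneg (show (0 : ℝ) ≤ n by positivity), ← sq_le_sq, mul_pow,
        Real.sq_sqrt (by positivity)]
      norm_num
      exact_mod_cast Iff.rfl
    rw [h1]
    rcases Nat.eq_zero_or_pos n with rfl | hn
    · simp; omega
    · rw [maxCommDim_of_pos hn]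
      omega
  obtain ⟨N, hN⟩ := Int.eq_ofNat_of_zero_le hpos
  rw [hN] at key ⊢
  have := (key (muComplexPow (k + 1))).mp le_rfl
  have := (key N).mpr le_rfl
  omega

end Abelian

end

/-! ### Commuting simple Lie algebras -/

section

open Module

attribute [local instance 100] LieRing.ofAssociativeRing

/-- V is a power of a simple module U, and End_R(U) = ℂ by Schur's lemma. -/
theorem IsIsotypic.exists_end_algEquiv_matrix {R V : Type*} [Ring R] [Algebra ℂ R]
    [AddCommGroup V] [Module ℂ V] [Module R V] [IsScalarTower ℂ R V] [FiniteDimensional ℂ V]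
    [IsSemisimpleModule R V] [Nontrivial V] (h : IsIsotypic R V) :
    ∃ (n : ℕ) (U : Submodule R V), 0 < n ∧ IsSimpleModule R U ∧ Nonempty (V ≃ₗ[R] (Fin n → U)) ∧
      Nonempty (Module.End R V ≃ₐ[ℂ] Matrix (Fin n) (Fin n) ℂ) := by
  have : Module.Finite R V := Module.Finite.of_restrictScalars_finite ℂ R V
  obtain ⟨n, hn, U, hU, ⟨e⟩⟩ := h.linearEquiv_fun
  refine ⟨n, U, Nat.pos_of_ne_zero hn.out, hU, ⟨e⟩, ?_⟩
  have : FiniteDimensional ℂ U := FiniteDimensional.finiteDimensional_submodule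
    (U.restrictScalars ℂ)
  have hbij : Function.Bijective (Algebra.ofId ℂ (Module.End R U)) := by
    have : Nontrivial U := IsSimpleModule.nontrivial R U
    refine ⟨FaithfulSMul.algebraMap_injective ℂ (Module.End R U), fun f ↦ ?_⟩
    obtain ⟨c, hc⟩ := exists_eq_smul_of_isSimpleModule (R := R) (V := U) f
    exact ⟨c, hc.symm⟩
  exact ⟨((e.conjAlgEquiv ℂ).trans (endVecAlgEquivMatrixEnd (Fin n) ℂ R U)).trans
    (AlgEquiv.ofBijective _ hbij).mapMatrix.symm⟩

theorem finrank_eq_mul_of_linearEquiv_fun {R V : Type*} [Ring R] [Algebra ℂ R]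
    [AddCommGroup V] [Module ℂ V] [Module R V] [IsScalarTower ℂ R V] [FiniteDimensional ℂ V]
    {n : ℕ} {U : Submodule R V} (e : V ≃ₗ[R] (Fin n → U)) :
    finrank ℂ V = n * finrank ℂ U := by
  have : FiniteDimensional ℂ U := FiniteDimensional.finiteDimensional_submodule
    (U.restrictScalars ℂ)
  rw [(e.restrictScalars ℂ).finrank_eq, finrank_pi_fintype]
  simp

theorem isSemisimpleModule_of_isotypicComponent_eq_top {R V S : Type*} [Ring R]
    [AddCommGroup V] [Module R V] [AddCommGroup S] [Module R S] [IsSemisimpleModule R S]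
    (h : isotypicComponent R V S = ⊤) : IsSemisimpleModule R V := by
  have h : IsSemisimpleModule R (⊤ : Submodule R V) := h ▸ inferInstance
  exact IsSemisimpleModule.congr (Submodule.topEquiv (R := R) (M := V)).symm

section Restriction

variable {L : Type*} [LieRing L] [LieAlgebra ℂ L] {V : Type*} [AddCommGroup V] [Module ℂ V]

/-- The restriction of a representation to an invariant subspace. -/
def LieHom.restrictInvariant (ρ : L →ₗ⁅ℂ⁆ Module.End ℂ V) (N : Submodule ℂ V)
    (h : ∀ x, ∀ v ∈ N, ρ x v ∈ N) : L →ₗ⁅ℂ⁆ Module.End ℂ N where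
  toFun x := (ρ x).restrict (h x)
  map_add' x y := by ext; simp
  map_smul' c x := by ext; simp
  map_lie' {x y} := by ext; simp [LieRing.of_associative_ring_bracket]

/-- The representation induced on the quotient by an invariant subspace. -/
def LieHom.quotientInvariant (ρ : L →ₗ⁅ℂ⁆ Module.End ℂ V) (N : Submodule ℂ V)
    (h : ∀ x, ∀ v ∈ N, ρ x v ∈ N) : L →ₗ⁅ℂ⁆ Module.End ℂ (V ⧸ N) where
  toFun x := N.mapQ N (ρ x) (h x)
  map_add' x y := by ext; simp
  map_smul' c x := by ext; simp
  map_lie' {x y} := by ext; simp [LieRing.of_associative_ring_bracket]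

/-- Any product ρ(x)ρ(y) vanishes, so the image is abelian, whereas a nonzero ρ would embed the
nonabelian L. -/
theorem LieAlgebra.IsSimple.eq_zero_of_restrict_of_quotient [LieAlgebra.IsSimple ℂ L]
    (ρ : L →ₗ⁅ℂ⁆ Module.End ℂ V) (N : Submodule ℂ V) (hN : ∀ x, ∀ v ∈ N, ρ x v = 0)
    (hQ : ∀ x v, ρ x v ∈ N) : ρ = 0 := by
  by_contra hρ
  refine LieAlgebra.IsSimple.non_abelian ℂ (L := L) ⟨fun x y ↦ ?_⟩
  apply LieAlgebra.IsSimple.injective_of_ne_zero hρ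
  ext v
  simp [LieRing.of_associative_ring_bracket, hN _ _ (hQ _ _)]

end Restriction

/-- Induction on dim V. If N is a proper nonzero invariant subspace, every factor acts nontrivially
on N or on V/N. If there is none, V is isotypic over the algebra generated by one factor i, V ≅ U^m;
factor i is faithful on U and the others act on the multiplicity space ℂ^m. Then m · dim U dominates
the sum, as dim U ≥ 2, and m ≥ 2 once another factor occurs. -/
theorem sum_lieMu_le_of_commute {ι : Type*} {s : ι → Type*} [∀ i, LieRing (s i)]
    [∀ i, LieAlgebra ℂ (s i)] [∀ i, LieAlgebra.IsSimple ℂ (s i)] (n : ℕ) :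
    ∀ (V : Type) [AddCommGroup V] [Module ℂ V] [FiniteDimensional ℂ V]
      (ρ : ∀ i, s i →ₗ⁅ℂ⁆ Module.End ℂ V) (A : Finset ι)
      (_ : ∀ i j, i ≠ j → ∀ x y, ρ i x * ρ j y = ρ j y * ρ i x) (_ : ∀ i ∈ A, ρ i ≠ 0),
      finrank ℂ V = n → ∑ i ∈ A, lieMu ℂ (s i) ≤ n := by
  classical
  induction n using Nat.strong_induction_on with
  | _ n ih =>
  intro V _ _ _ ρ A hcomm hA hV
  rcases A.eq_empty_or_nonempty with rfl | ⟨i, hi⟩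
  · simp
  by_cases hsimple : ∃ N : Submodule ℂ V, (∀ i x, ∀ v ∈ N, ρ i x v ∈ N) ∧ N ≠ ⊥ ∧ N ≠ ⊤
  · obtain ⟨N, hN, hbot, htop⟩ := hsimple
    have hlt : finrank ℂ N < n := hV ▸ Submodule.finrank_lt htop
    have hpos : 0 < finrank ℂ N := by
      rwa [Nat.pos_iff_ne_zero, Ne, Submodule.finrank_eq_zero]
    have hadd := Submodule.finrank_quotient_add_finrank N
    have h1 := ih _ hlt N (fun i ↦ (ρ i).restrictInvariant N (hN i))
      (A.filter fun i ↦ (ρ i).restrictInvariant N (hN i) ≠ 0)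
      (fun i j hij x y ↦ by
        ext v
        exact LinearMap.congr_fun (hcomm i j hij x y) v)
      (fun i hi ↦ (Finset.mem_filter.mp hi).2) rfl
    have h2 := ih (finrank ℂ (V ⧸ N)) (by omega) (V ⧸ N)
      (fun i ↦ (ρ i).quotientInvariant N (hN i))
      (A.filter fun i ↦ (ρ i).quotientInvariant N (hN i) ≠ 0)
      (fun i j hij x y ↦ by
        ext v
        exact congrArg N.mkQ (LinearMap.congr_fun (hcomm i j hij x y) v))
      (fun i hi ↦ (Finset.mem_filter.mp hi).2) rfl
    have hsub : A ⊆ (A.filter fun i ↦ (ρ i).restrictInvariant N (hN i) ≠ 0) ∪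
        (A.filter fun i ↦ (ρ i).quotientInvariant N (hN i) ≠ 0) := fun j hj ↦ by
      by_contra hcon
      simp only [Finset.mem_union, Finset.mem_filter, hj, true_and, not_or, not_not] at hcon
      refine hA j hj (LieAlgebra.IsSimple.eq_zero_of_restrict_of_quotient (ρ j) N
        (fun x v hv ↦ ?_) (fun x v ↦ ?_))
      · exact congrArg Subtype.val (LinearMap.congr_fun (LieHom.congr_fun hcon.1 x) ⟨v, hv⟩)
      · exact (Submodule.Quotient.mk_eq_zero N).mp
          (LinearMap.congr_fun (LieHom.congr_fun hcon.2 x) (N.mkQ v))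
    have h3 := Finset.sum_le_sum_of_subset (f := fun i ↦ lieMu ℂ (s i)) hsub
    have h4 := Finset.sum_union_inter (f := fun i ↦ lieMu ℂ (s i))
      (s₁ := A.filter fun i ↦ (ρ i).restrictInvariant N (hN i) ≠ 0)
      (s₂ := A.filter fun i ↦ (ρ i).quotientInvariant N (hN i) ≠ 0)
    omega
  · have hinv : ∀ N : Submodule ℂ V, (∀ i x, ∀ v ∈ N, ρ i x v ∈ N) → N ≠ ⊥ → N = ⊤ :=
      fun N hN hbot ↦ by_contra fun htop ↦ hsimple ⟨N, hN, hbot, htop⟩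
    have : Nontrivial V := by
      by_contra hV'
      rw [not_nontrivial_iff_subsingleton] at hV'
      exact hA i hi (by ext; exact Subsingleton.elim _ _)
    let R := Algebra.adjoin ℂ (Set.range (ρ i))
    have hRcomm : ∀ r : R, ∀ j, j ≠ i → ∀ x, ρ j x * r = r * ρ j x := fun r j hj x ↦ by
      have h : (r : Module.End ℂ V) ∈ Subalgebra.centralizer ℂ {ρ j x} :=
        (Algebra.adjoin_le fun y hy ↦ by
          obtain ⟨y, rfl⟩ := hy
          rw [SetLike.mem_coe, Subalgebra.mem_centralizer_iff]
          rintro z rfl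
          exact hcomm j i hj x y) r.2
      exact (Subalgebra.mem_centralizer_iff ℂ).mp h _ rfl
    have : IsArtinian R V := isArtinian_of_tower ℂ inferInstance
    obtain ⟨U₀, hU₀⟩ := IsAtomic.exists_atom (Submodule R V)
    have hU₀' : IsSimpleModule R U₀ := isSimpleModule_iff_isAtom.mpr hU₀
    -- the action of the other factors, as `R`-linear endomorphisms
    let endo : ∀ j, j ≠ i → s j →ₗ⁅ℂ⁆ Module.End R V := fun j hj ↦
      { toFun := fun x ↦
          { toFun := ρ j x
            map_add' := map_add _
            map_smul' := fun r v ↦ LinearMap.congr_fun (hRcomm r j hj x) v }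
        map_add' := fun x y ↦ by ext; simp
        map_smul' := fun c x ↦ by ext; simp
        map_lie' := fun {x y} ↦ by ext; simp [LieRing.of_associative_ring_bracket] }
    -- The isotypic component is stable under factor i as an R-submodule, and under the other
    -- factors because they act by R-endomorphisms.
    have htop : isotypicComponent R V U₀ = ⊤ := by
      have := hinv ((isotypicComponent R V U₀).restrictScalars ℂ) (fun j x v hv ↦ by
        by_cases hj : j = i
        · subst hj
          exact (isotypicComponent R V U₀).smul_mem
            (⟨ρ j x, Algebra.subset_adjoin ⟨x, rfl⟩⟩ : R) hv
        · exact Submodule.IsFullyInvariant.isotypicComponent R V U₀ (endo j hj x) hv) (by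
        rw [Ne, Submodule.restrictScalars_eq_bot_iff]
        exact (bot_lt_isotypicComponent U₀).ne')
      rwa [Submodule.restrictScalars_eq_top_iff] at this
    have : IsSemisimpleModule R V := isSemisimpleModule_of_isotypicComponent_eq_top htop
    obtain ⟨m, U, hm, hU, ⟨e⟩, ⟨ε⟩⟩ :=
      ((IsIsotypicOfType.of_isotypicComponent_eq_top htop).isIsotypic).exists_end_algEquiv_matrix
    have hdim := finrank_eq_mul_of_linearEquiv_fun e
    rw [hV] at hdim
    have hfinU : FiniteDimensional ℂ (U.restrictScalars ℂ) := inferInstance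
    have hρU : ∀ x, ∀ v ∈ U.restrictScalars ℂ, ρ i x v ∈ U.restrictScalars ℂ := fun x v hv ↦
      U.smul_mem (⟨ρ i x, Algebra.subset_adjoin ⟨x, rfl⟩⟩ : R) hv
    have hne : (ρ i).restrictInvariant (U.restrictScalars ℂ) hρU ≠ 0 := fun h0 ↦ by
      refine hA i hi ?_
      ext x v
      apply e.injective
      have h1 := e.map_smul (⟨ρ i x, Algebra.subset_adjoin ⟨x, rfl⟩⟩ : R) v
      refine h1.trans ?_
      rw [LieHom.zero_apply, LinearMap.zero_apply, map_zero]
      funext k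
      exact LinearMap.congr_fun (LieHom.congr_fun h0 x) (e v k)
    have hμi : lieMu ℂ (s i) ≤ finrank ℂ U :=
      lieMu_le_finrank _ (LieAlgebra.IsSimple.injective_of_ne_zero hne)
    have htwo : ∀ j ∈ A, 2 ≤ lieMu ℂ (s j) := fun j hj ↦
      two_le_lieMu (LieAlgebra.IsSimple.non_abelian ℂ)
        ⟨_, finrank_mem_faithfulRepDims (ρ j) (LieAlgebra.IsSimple.injective_of_ne_zero (hA j hj))⟩
    let ε' : Module.End R V ≃ₐ[ℂ] Module.End ℂ (Fin m → ℂ) := ε.trans Matrix.toLinAlgEquiv'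
    -- Factor i need not act R-linearly, so it is assigned the zero action; it is erased from the
    -- index set below.
    let σ : ∀ j, s j →ₗ⁅ℂ⁆ Module.End ℂ (Fin m → ℂ) := fun j ↦
      if hj : j = i then 0 else (ε' : _ →ₐ[ℂ] _).toLieHom.comp (endo j hj)
    have hσ : ∀ j (hj : j ≠ i) x, σ j x = ε' (endo j hj x) := fun j hj x ↦ by
      simp only [σ, dif_neg hj]; rfl
    have hσi : σ i = 0 := by simp [σ]
    have hmn : m < n := by
      have := htwo i hi
      rw [hdim]
      nlinarith
    have hrest := ih m hmn (Fin m → ℂ) σ (A.erase i) (fun j k hjk x y ↦ by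
        by_cases hj : j = i
        · subst hj; simp [hσi]
        by_cases hk : k = i
        · subst hk; simp [hσi]
        rw [hσ j hj, hσ k hk, ← map_mul, ← map_mul]
        congr 1
        ext v
        exact LinearMap.congr_fun (hcomm j k hjk x y) v)
      (fun j hj h0 ↦ by
        obtain ⟨hj, hjA⟩ := Finset.mem_erase.mp hj
        refine hA j hjA ?_
        ext x v
        have h1 : ε' (endo j hj x) = 0 := by rw [← hσ j hj, h0]; rfl
        have h2 := (map_eq_zero_iff ε' ε'.injective).mp h1
        exact LinearMap.congr_fun h2 v) (by simp)
    rw [← Finset.add_sum_erase A _ hi, hdim]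
    have := htwo i hi
    rcases (A.erase i).eq_empty_or_nonempty with h0 | ⟨j, hj⟩
    · rw [h0, Finset.sum_empty]
      nlinarith
    · have h5 : 2 ≤ ∑ k ∈ A.erase i, lieMu ℂ (s k) :=
        (htwo j (Finset.mem_of_mem_erase hj)).trans
          (Finset.single_le_sum (f := fun k ↦ lieMu ℂ (s k)) (fun _ _ ↦ Nat.zero_le _) hj)
      nlinarith

end

/-! ### Simple ideals together with a commuting space of endomorphisms -/

section

open Module

attribute [local instance 100] LieRing.ofAssociativeRing

/-- The numerical bound satisfied by a module of dimension `d` with a commuting space of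
endomorphisms of dimension `z`, when the ideals indexed by `A` act nontrivially. -/
def CommutingBound {ι : Type*} (μ : ι → ℕ) (A : Finset ι) (z d : ℕ) : Prop :=
  ∃ b, d = ∑ i ∈ A, μ i + b ∧ z ≤ A.card + maxCommDim b

/-- An ideal in both sets is counted twice in d + d' but once in the union. Its second copy of μ
moves into the remainder b, where it makes up for the lost unit of cardinality because n ≤ M(n). -/
theorem CommutingBound.union {ι : Type*} [DecidableEq ι] {μ : ι → ℕ} (hμ : ∀ i, 2 ≤ μ i)
    {A A' : Finset ι} {z z' d d' : ℕ} (h : CommutingBound μ A z d)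
    (h' : CommutingBound μ A' z' d') : CommutingBound μ (A ∪ A') (z + z') (d + d') := by
  obtain ⟨b, rfl, hz⟩ := h
  obtain ⟨b', rfl, hz'⟩ := h'
  have hsum := Finset.sum_union_inter (s₁ := A) (s₂ := A') (f := μ)
  have hcard := Finset.card_union_add_card_inter A A'
  have hle : (A ∩ A').card ≤ ∑ i ∈ A ∩ A', μ i := by
    rw [Finset.card_eq_sum_ones]
    exact Finset.sum_le_sum fun i _ ↦ le_trans one_le_two (hμ i)
  refine ⟨b + b' + ∑ i ∈ A ∩ A', μ i, by omega, ?_⟩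
  have h1 := maxCommDim_add b b'
  have h2 := maxCommDim_add (b + b') (∑ i ∈ A ∩ A', μ i)
  have h3 := le_maxCommDim (∑ i ∈ A ∩ A', μ i)
  omega

section Socle

variable (R V : Type*) [Ring R] [AddCommGroup V] [Module R V]

/-- The socle of a module: the sum of its simple submodules. -/
def moduleSocle : Submodule R V := sSup {m | IsSimpleModule R m}

variable {R V}

/-- The image of a simple submodule is simple or zero. In particular every endomorphism preserves
the socle, so the commuting space can be degenerated along it. -/
theorem moduleSocle_le_comap {V' : Type*} [AddCommGroup V'] [Module R V'] (f : V →ₗ[R] V') :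
    moduleSocle R V ≤ (moduleSocle R V').comap f := by
  refine sSup_le fun m hm ↦ ?_
  have hm : IsSimpleModule R m := hm
  rw [← Submodule.map_le_iff_le_comap, ← m.range_subtype, ← LinearMap.range_comp]
  obtain inj | eq := (f ∘ₗ m.subtype).injective_or_eq_zero
  · exact le_sSup (IsSimpleModule.congr (LinearEquiv.ofInjective _ inj).symm)
  · simp [eq]

theorem moduleSocle_eq_top [IsSemisimpleModule R V] : moduleSocle R V = ⊤ :=
  IsSemisimpleModule.sSup_simples_eq_top R V

instance isSemisimpleModule_moduleSocle : IsSemisimpleModule R (moduleSocle R V) := by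
  rw [moduleSocle, sSup_eq_iSup]
  refine isSemisimpleModule_biSup_of_isSemisimpleModule_submodule fun m hm ↦ ?_
  have hm : IsSimpleModule R m := hm
  infer_instance

end Socle

theorem finrank_le_sum_finrank_map {K : Type*} [Field K] {W κ : Type*} [AddCommGroup W]
    [Module K W] [Fintype κ] {M : κ → Type*} [∀ c, AddCommGroup (M c)] [∀ c, Module K (M c)]
    [∀ c, FiniteDimensional K (M c)] (g : ∀ c, W →ₗ[K] M c) (Z : Submodule K W)
    (hg : ∀ x ∈ Z, (∀ c, g c x = 0) → x = 0) :
    finrank K Z ≤ ∑ c, finrank K (Z.map (g c)) := by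
  rw [← finrank_pi_fintype]
  let j : Z →ₗ[K] ∀ c, Z.map (g c) := LinearMap.pi fun c ↦
    (g c).restrict (fun z hz ↦ Submodule.mem_map_of_mem hz)
  refine LinearMap.finrank_le_finrank_of_injective (f := j) ?_
  rw [injective_iff_map_eq_zero]
  exact fun x hx ↦ Subtype.ext (hg x x.2 fun c ↦ congrArg Subtype.val (congrFun hx c))

section Bound

variable {R : Type} [Ring R] [Algebra ℂ R]

theorem finiteDimensional_quotient_of_tower {V : Type*} [AddCommGroup V] [Module ℂ V] [Module R V]
    [IsScalarTower ℂ R V] [FiniteDimensional ℂ V] (N : Submodule R V) :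
    FiniteDimensional ℂ (V ⧸ N) :=
  Module.Finite.of_surjective (N.mkQ.restrictScalars ℂ) N.mkQ_surjective

theorem finrank_prod_quotient_of_tower {V : Type*} [AddCommGroup V] [Module ℂ V] [Module R V]
    [IsScalarTower ℂ R V] [FiniteDimensional ℂ V] (N : Submodule R V) :
    finrank ℂ (N × (V ⧸ N)) = finrank ℂ V := by
  have := finiteDimensional_quotient_of_tower N
  have : FiniteDimensional ℂ N := FiniteDimensional.finiteDimensional_submodule
    (N.restrictScalars ℂ)
  have h := Submodule.finrank_quotient_add_finrank (N.restrictScalars ℂ)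
  rw [(Submodule.Quotient.restrictScalarsEquiv ℂ N).finrank_eq] at h
  rw [finrank_prod, add_comm]
  exact h

/-- A commuting space of endomorphisms of `V` preserving `N` degenerates to a commuting space of
endomorphisms of `N × (V ⧸ N)` of the same dimension. -/
theorem exists_commuting_prod_quotient {V : Type*} [AddCommGroup V] [Module ℂ V] [Module R V]
    [IsScalarTower ℂ R V] [FiniteDimensional ℂ V] (N : Submodule R V)
    (Z : Submodule ℂ (Module.End R V)) (hZ : ∀ x ∈ Z, ∀ y ∈ Z, x * y = y * x)
    (hN : ∀ z ∈ Z, N ≤ N.comap z) :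
    ∃ Z' : Submodule ℂ (Module.End R (N × (V ⧸ N))), (∀ x ∈ Z', ∀ y ∈ Z', x * y = y * x) ∧
      finrank ℂ Z' = finrank ℂ Z := by
  let resN : Z →ₗ[ℂ] Module.End R N :=
    { toFun := fun z ↦ (z : Module.End R V).restrict (hN z z.2)
      map_add' := fun _ _ ↦ rfl
      map_smul' := fun _ _ ↦ rfl }
  let resQ : Z →ₗ[ℂ] Module.End R (V ⧸ N) :=
    { toFun := fun z ↦ N.mapQ N (z : Module.End R V) (hN z z.2)
      map_add' := fun _ _ ↦ by ext; rfl
      map_smul' := fun _ _ ↦ by ext; rfl }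
  let K : Submodule ℂ Z := LinearMap.ker (resN.prod resQ)
  have hKN : ∀ k : K, ∀ v ∈ N, (k : Z).1 v = 0 := fun k v hv ↦
    congrArg Subtype.val (LinearMap.congr_fun (congrArg Prod.fst (LinearMap.mem_ker.mp k.2))
      (⟨v, hv⟩ : N))
  have hKQ : ∀ k : K, ∀ v, (k : Z).1 v ∈ N := fun k v ↦
    (Submodule.Quotient.mk_eq_zero N).mp
      (LinearMap.congr_fun (congrArg Prod.snd (LinearMap.mem_ker.mp k.2)) (N.mkQ v))
  let off : K →ₗ[ℂ] ((V ⧸ N) →ₗ[R] N) :=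
    { toFun := fun k ↦ N.liftQ ((k : Z).1.codRestrict N (hKQ k)) (by
        rw [LinearMap.ker_codRestrict]; exact fun v hv ↦ hKN k v hv)
      map_add' := fun _ _ ↦ by ext; rfl
      map_smul' := fun _ _ ↦ by ext; rfl }
  -- K consists of the operators invisible on both N and V/N. A linear retraction p onto K lets the
  -- off-diagonal entry remember that part; no multiplicative property of p is needed.
  obtain ⟨p, hp⟩ := LinearMap.exists_leftInverse_of_injective (K := ℂ) (V := K) (V' := Z)
    K.subtype K.ker_subtype
  let θ : Z →ₗ[ℂ] Module.End R (N × (V ⧸ N)) :=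
    { toFun := fun z ↦ LinearMap.prod
        (resN z ∘ₗ LinearMap.fst R N (V ⧸ N) + off (p z) ∘ₗ LinearMap.snd R N (V ⧸ N))
        (resQ z ∘ₗ LinearMap.snd R N (V ⧸ N))
      map_add' := fun x y ↦ by
        refine LinearMap.ext fun a ↦ Prod.ext ?_ ?_
        · change resN (x + y) a.1 + off (p (x + y)) a.2 =
            (resN x a.1 + off (p x) a.2) + (resN y a.1 + off (p y) a.2)
          rw [map_add, map_add, map_add, LinearMap.add_apply, LinearMap.add_apply,
            add_add_add_comm]
        · change resQ (x + y) a.2 = resQ x a.2 + resQ y a.2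
          rw [map_add, LinearMap.add_apply]
      map_smul' := fun c x ↦ by
        refine LinearMap.ext fun a ↦ Prod.ext ?_ ?_
        · change resN (c • x) a.1 + off (p (c • x)) a.2 = c • (resN x a.1 + off (p x) a.2)
          rw [map_smul, map_smul, map_smul, LinearMap.smul_apply, LinearMap.smul_apply, smul_add]
        · change resQ (c • x) a.2 = c • resQ x a.2
          rw [map_smul, LinearMap.smul_apply] }
  have hθ : ∀ z a q, θ z (a, q) = (resN z a + off (p z) q, resQ z q) := fun _ _ _ ↦ rfl
  have hinj : Function.Injective θ := by
    rw [injective_iff_map_eq_zero]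
    intro z hz
    have h1 : resN z = 0 := by
      ext a
      have := congrArg Prod.fst (LinearMap.congr_fun hz (a, 0))
      rw [hθ] at this
      simpa using this
    have h2 : resQ z = 0 := by
      refine LinearMap.ext fun q ↦ ?_
      have := congrArg Prod.snd (LinearMap.congr_fun hz (0, q))
      rw [hθ] at this
      simpa using this
    have hzK : z ∈ K := by
      exact LinearMap.mem_ker.mpr (Prod.ext h1 h2)
    have h3 : p z = ⟨z, hzK⟩ := LinearMap.congr_fun hp ⟨z, hzK⟩
    ext v
    have := congrArg Prod.fst (LinearMap.congr_fun hz (0, N.mkQ v))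
    rw [hθ, h3, map_zero, zero_add] at this
    exact congrArg Subtype.val this
  -- Elements of K commute with Z, so off-diagonal entries intertwine the two diagonal actions. This
  -- makes the mixed terms of a product of two images under θ symmetric.
  have hcomm : ∀ z (k : K) q, resN z (off k q) = off k (resQ z q) := fun z k q ↦ by
    obtain ⟨v, rfl⟩ := N.mkQ_surjective q
    ext
    exact LinearMap.congr_fun (hZ z z.2 (k : Z) (k : Z).2) v
  have hcommN : ∀ x y a, resN x (resN y a) = resN y (resN x a) := fun x y a ↦ by
    ext
    exact LinearMap.congr_fun (hZ x x.2 y y.2) (a : V)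
  have hcommQ : ∀ x y q, resQ x (resQ y q) = resQ y (resQ x q) := fun x y q ↦ by
    obtain ⟨v, rfl⟩ := N.mkQ_surjective q
    exact congrArg N.mkQ (LinearMap.congr_fun (hZ x x.2 y y.2) v)
  refine ⟨LinearMap.range θ, ?_, LinearMap.finrank_range_of_inj hinj⟩
  rintro _ ⟨x, rfl⟩ _ ⟨y, rfl⟩
  refine LinearMap.ext fun ⟨a, q⟩ ↦ ?_
  rw [Module.End.mul_apply, Module.End.mul_apply, hθ, hθ, hθ, hθ, map_add, map_add, hcomm, hcomm,
    hcommN x y, hcommQ x y, add_assoc, add_assoc, add_comm (off (p y) (resQ x q))]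

variable {ι : Type*} {s : ι → Type*} [∀ i, LieRing (s i)] [∀ i, LieAlgebra ℂ (s i)]
  [∀ i, LieAlgebra.IsSimple ℂ (s i)]

/-- Write V ≅ Uⁿ and let A be the set of ideals acting nontrivially on U. Schur's bound gives dim Z
≤ M(n), while ∑ μ over A is at most dim U, so at least (n - 1) dim U dimensions remain for b. -/
theorem exists_commutingBound_of_isIsotypic [Finite ι] (f : ∀ i, s i →ₗ⁅ℂ⁆ R)
    (hf : ∀ i j, i ≠ j → ∀ x y, f i x * f j y = f j y * f i x)
    (hμ : ∀ i, 2 ≤ lieMu ℂ (s i)) {V : Type} [AddCommGroup V] [Module ℂ V] [Module R V]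
    [IsScalarTower ℂ R V] [FiniteDimensional ℂ V] [IsSemisimpleModule R V] [Nontrivial V]
    (hV : IsIsotypic R V) (Z : Submodule ℂ (Module.End R V))
    (hZ : ∀ x ∈ Z, ∀ y ∈ Z, x * y = y * x) :
    ∃ A : Finset ι, (∀ i ∉ A, ∀ x, ∀ v : V, f i x • v = 0) ∧
      CommutingBound (fun i ↦ lieMu ℂ (s i)) A (finrank ℂ Z) (finrank ℂ V) := by
  classical
  have := Fintype.ofFinite ι
  obtain ⟨n, U, hn, hU, ⟨e⟩, ⟨ε⟩⟩ := hV.exists_end_algEquiv_matrix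
  have hdim := finrank_eq_mul_of_linearEquiv_fun e
  have : FiniteDimensional ℂ U := FiniteDimensional.finiteDimensional_submodule
    (U.restrictScalars ℂ)
  have : Nontrivial U := IsSimpleModule.nontrivial R U
  have hUpos : 0 < finrank ℂ U := finrank_pos
  let ε' : Module.End R V ≃ₐ[ℂ] Module.End ℂ (Fin n → ℂ) := ε.trans Matrix.toLinAlgEquiv'
  have hz : finrank ℂ Z ≤ maxCommDim n := by
    rw [← LinearEquiv.finrank_map_eq ε'.toLinearEquiv Z]
    refine finrank_le_maxCommDim_of_commute _ ?_ (by simp)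
    rintro _ ⟨x, hx, rfl⟩ _ ⟨y, hy, rfl⟩
    simpa using congrArg ε' (hZ x hx y hy)
  let ρ : ∀ i, s i →ₗ⁅ℂ⁆ Module.End ℂ U := fun i ↦
    (Algebra.lsmul ℂ ℂ U).toLieHom.comp (f i)
  let A : Finset ι := Finset.univ.filter fun i ↦ ρ i ≠ 0
  have hA : ∑ i ∈ A, lieMu ℂ (s i) ≤ finrank ℂ U :=
    sum_lieMu_le_of_commute _ U ρ A (fun i j hij x y ↦ by
      have := congrArg (Algebra.lsmul ℂ ℂ U) (hf i j hij x y)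
      rw [map_mul, map_mul] at this
      exact this) (fun i hi ↦ (Finset.mem_filter.mp hi).2) rfl
  refine ⟨A, fun i hi x v ↦ ?_, n * finrank ℂ U - ∑ i ∈ A, lieMu ℂ (s i), ?_, hz.trans ?_⟩
  · have h0 : ρ i = 0 := by simpa [A] using hi
    apply e.injective
    rw [map_smul, map_zero]
    funext k
    exact LinearMap.congr_fun (LieHom.congr_fun h0 x) (e v k)
  · have : finrank ℂ U ≤ n * finrank ℂ U := Nat.le_mul_of_pos_left _ hn
    change finrank ℂ V = ∑ i ∈ A, lieMu ℂ (s i) + _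
    rw [hdim]
    omega
  · rcases A.eq_empty_or_nonempty with h0 | ⟨i, hi⟩
    · rw [h0, Finset.sum_empty, Finset.card_empty, zero_add, Nat.sub_zero]
      exact maxCommDim_mono (Nat.le_mul_of_pos_right _ hUpos)
    · have h2 : 2 ≤ finrank ℂ U := (hμ i).trans
        ((Finset.single_le_sum (f := fun k ↦ lieMu ℂ (s k)) (fun _ _ ↦ Nat.zero_le _) hi).trans hA)
      obtain ⟨m, rfl⟩ : ∃ m, n = m + 1 := ⟨n - 1, by omega⟩
      refine (maxCommDim_le_succ _ m h2).trans (Nat.add_le_add (Finset.card_pos.mpr ⟨i, hi⟩)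
        (maxCommDim_mono ?_))
      rw [add_mul, one_mul, mul_comm]
      omega

/-- Endomorphisms preserve isotypic components, so Z embeds in the product of its projections to
them. The bounds on the components combine by `CommutingBound.union`. -/
theorem exists_commutingBound_of_isSemisimpleModule [Finite ι] (f : ∀ i, s i →ₗ⁅ℂ⁆ R)
    (hf : ∀ i j, i ≠ j → ∀ x y, f i x * f j y = f j y * f i x)
    (hμ : ∀ i, 2 ≤ lieMu ℂ (s i)) {V : Type} [AddCommGroup V] [Module ℂ V] [Module R V]
    [IsScalarTower ℂ R V] [FiniteDimensional ℂ V] [IsSemisimpleModule R V]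
    (Z : Submodule ℂ (Module.End R V)) (hZ : ∀ x ∈ Z, ∀ y ∈ Z, x * y = y * x) :
    ∃ A : Finset ι, (∀ i ∉ A, ∀ x, ∀ v : V, f i x • v = 0) ∧
      ∃ z, finrank ℂ Z ≤ z ∧ CommutingBound (fun i ↦ lieMu ℂ (s i)) A z (finrank ℂ V) := by
  classical
  have : IsNoetherian R V := isNoetherian_of_tower ℂ inferInstance
  have := Fintype.ofFinite (isotypicComponents R V)
  have hfin : ∀ c : isotypicComponents R V, FiniteDimensional ℂ c.1 := fun c ↦
    FiniteDimensional.finiteDimensional_submodule (c.1.restrictScalars ℂ)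
  let E := IsSemisimpleModule.endAlgEquiv ℂ R V
  let g : ∀ c : isotypicComponents R V, Module.End R V →ₗ[ℂ] Module.End R c.1 := fun c ↦
    { toFun := fun x ↦ E x c
      map_add' := fun x y ↦ congrFun (map_add E x y) c
      map_smul' := fun a x ↦ congrFun (map_smul E a x) c }
  let Zc : ∀ c : isotypicComponents R V, Submodule ℂ (Module.End R c.1) := fun c ↦ Z.map (g c)
  have hbound := fun c : isotypicComponents R V ↦ exists_commutingBound_of_isIsotypic f hf hμ
    (IsIsotypic.isotypicComponents c.2) (Zc c) (by
      rintro _ ⟨x, hx, rfl⟩ _ ⟨y, hy, rfl⟩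
      have := congrFun (congrArg E (hZ x hx y hy)) c
      rwa [map_mul, map_mul] at this)
  have hsum : ∀ T : Finset (isotypicComponents R V), ∃ A : Finset ι,
      (∀ i ∉ A, ∀ c ∈ T, ∀ x, ∀ v : c.1, f i x • v = 0) ∧
      CommutingBound (fun i ↦ lieMu ℂ (s i)) A (∑ c ∈ T, finrank ℂ (Zc c))
        (∑ c ∈ T, finrank ℂ c.1) := fun T ↦ by
    induction T using Finset.induction_on with
    | empty => exact ⟨∅, by simp, 0, by simp, by simp⟩
    | insert c T hc ih =>
      obtain ⟨A, hA, hA'⟩ := ih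
      obtain ⟨B, hB, hB'⟩ := hbound c
      refine ⟨B ∪ A, fun i hi d hd ↦ ?_, ?_⟩
      · rw [Finset.notMem_union] at hi
        rcases Finset.mem_insert.mp hd with rfl | hd
        · exact hB i hi.1
        · exact hA i hi.2 d hd
      · rw [Finset.sum_insert hc, Finset.sum_insert hc]
        exact hB'.union hμ hA'
  obtain ⟨A, hA, hA'⟩ := hsum Finset.univ
  have hind := (sSupIndep_iff _).mp (sSupIndep_isotypicComponents R V)
  have htop : ⨆ c : isotypicComponents R V, c.1 = ⊤ :=
    (sSup_eq_iSup' _).symm.trans (sSup_isotypicComponents R V)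
  have hdim : finrank ℂ V = ∑ c : isotypicComponents R V, finrank ℂ c.1 := by
    rw [← finrank_pi_fintype]
    exact (((hind.linearEquiv htop).symm.trans
      DFinsupp.linearEquivFunOnFintype).restrictScalars ℂ).finrank_eq
  refine ⟨A, fun i hi x v ↦ ?_, _, ?_, hdim ▸ hA'⟩
  · have hv : v ∈ ⨆ c : isotypicComponents R V, c.1 := htop ▸ Submodule.mem_top
    refine Submodule.iSup_induction _ (motive := fun v ↦ f i x • v = 0) hv ?_ (smul_zero _) ?_
    · exact fun c v hv ↦ congrArg Subtype.val (hA i hi c (Finset.mem_univ _) x ⟨v, hv⟩)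
    · intro v w hv hw
      rw [smul_add, hv, hw, add_zero]
  · exact finrank_le_sum_finrank_map g Z fun x _ hx ↦
      E.injective ((funext hx).trans (map_zero E).symm)

/-- Induction on the codimension of the socle N. Passing to N × V/N keeps dim V and dim Z; the new
socle contains N together with a simple submodule of V/N, so the codimension drops. -/
theorem exists_commutingBound [Finite ι] (f : ∀ i, s i →ₗ⁅ℂ⁆ R)
    (hf : ∀ i j, i ≠ j → ∀ x y, f i x * f j y = f j y * f i x)
    (hμ : ∀ i, 2 ≤ lieMu ℂ (s i)) (n : ℕ) : ∀ {V : Type} [AddCommGroup V] [Module ℂ V]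
    [Module R V] [IsScalarTower ℂ R V] [FiniteDimensional ℂ V]
    (Z : Submodule ℂ (Module.End R V)) (_ : ∀ x ∈ Z, ∀ y ∈ Z, x * y = y * x),
    finrank ℂ V - finrank ℂ (moduleSocle R V) = n →
    ∃ A : Finset ι, (∀ i ∉ A, ∀ x, ∀ v : V, f i x • v = 0) ∧
      ∃ z, finrank ℂ Z ≤ z ∧ CommutingBound (fun i ↦ lieMu ℂ (s i)) A z (finrank ℂ V) := by
  induction n using Nat.strong_induction_on with
  | _ n ih =>
  intro V _ _ _ _ _ Z hZ hn
  by_cases htop : moduleSocle R V = ⊤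
  · have : IsSemisimpleModule R V := IsSemisimpleModule.of_sSup_simples_eq_top htop
    exact exists_commutingBound_of_isSemisimpleModule f hf hμ Z hZ
  set N := moduleSocle R V with hN
  have := finiteDimensional_quotient_of_tower N
  have : FiniteDimensional ℂ N := FiniteDimensional.finiteDimensional_submodule
    (N.restrictScalars ℂ)
  obtain ⟨Z', hZ', hrank⟩ := exists_commuting_prod_quotient N Z hZ
    (fun z _ ↦ moduleSocle_le_comap z)
  have hdim := finrank_prod_quotient_of_tower N
  have hlt : finrank ℂ N < finrank ℂ (moduleSocle R (N × (V ⧸ N))) := by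
    have : Nontrivial (V ⧸ N) := Submodule.Quotient.nontrivial_iff.mpr htop
    have : IsArtinian R (V ⧸ N) := isArtinian_of_tower ℂ inferInstance
    obtain ⟨m, hm⟩ := IsAtomic.exists_atom (Submodule R (V ⧸ N))
    have hm' : IsSimpleModule R m := isSimpleModule_iff_isAtom.mpr hm
    have : Nontrivial m := IsSimpleModule.nontrivial R m
    obtain ⟨q, hq⟩ := exists_ne (0 : m)
    have hqs : LinearMap.inr R N (V ⧸ N) q ∈ moduleSocle R (N × (V ⧸ N)) :=
      moduleSocle_le_comap _ (le_sSup (a := m) hm' q.2)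
    have hinl : LinearMap.range (LinearMap.inl R N (V ⧸ N)) ≤ moduleSocle R (N × (V ⧸ N)) := by
      rw [LinearMap.range_eq_map, Submodule.map_le_iff_le_comap,
        ← moduleSocle_eq_top (R := R) (V := N)]
      exact moduleSocle_le_comap _
    have hfr : finrank ℂ N = finrank ℂ
        ((LinearMap.range (LinearMap.inl R N (V ⧸ N))).restrictScalars ℂ) :=
      ((LinearEquiv.ofInjective (LinearMap.inl R N (V ⧸ N))
        LinearMap.inl_injective).restrictScalars ℂ).finrank_eq
    rw [hfr]
    refine Submodule.finrank_lt_finrank_of_lt (t := (moduleSocle R (N × (V ⧸ N))).restrictScalars ℂ)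
      (lt_of_le_of_ne hinl fun heq ↦ hq ?_)
    have h1 : LinearMap.inr R N (V ⧸ N) q ∈
        (LinearMap.range (LinearMap.inl R N (V ⧸ N))).restrictScalars ℂ := heq ▸ hqs
    obtain ⟨a, ha⟩ := h1
    exact Subtype.ext (congrArg Prod.snd ha).symm
  have hle : finrank ℂ (moduleSocle R (N × (V ⧸ N))) ≤ finrank ℂ (N × (V ⧸ N)) :=
    Submodule.finrank_le ((moduleSocle R (N × (V ⧸ N))).restrictScalars ℂ)
  obtain ⟨A, hA, hA'⟩ := ih _ (by omega) Z' hZ' rfl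
  rw [hdim, hrank] at hA'
  refine ⟨A, fun i hi x v ↦ ?_, hA'⟩
  let ρ : s i →ₗ⁅ℂ⁆ Module.End ℂ V := (Algebra.lsmul ℂ ℂ V).toLieHom.comp (f i)
  -- Acting by zero on N and V/N leaves room only for a nilpotent action, which simplicity excludes.
  have hρ : ρ = 0 := LieAlgebra.IsSimple.eq_zero_of_restrict_of_quotient ρ (N.restrictScalars ℂ)
    (fun x v hv ↦ congrArg (fun a : N × (V ⧸ N) ↦ (a.1 : V)) (hA i hi x (⟨v, hv⟩, 0)))
    (fun x v ↦ (Submodule.Quotient.mk_eq_zero N).mp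
      (congrArg Prod.snd (hA i hi x (0, N.mkQ v))))
  exact LinearMap.congr_fun (LieHom.congr_fun hρ x) v

end Bound

end

/-! ### Reductive Lie algebras -/

section

open Module

attribute [local instance 100] LieRing.ofAssociativeRing

section InternalDirectSum

variable {K V κ : Type*} [Field K]

theorem DirectSum.IsInternal.exists_projections [Fintype κ] [DecidableEq κ] [AddCommGroup V] [Module K V]
    {N : κ → Submodule K V} (h : DirectSum.IsInternal N) :
    ∃ π : κ → V →ₗ[K] V, (∀ o x, π o x ∈ N o) ∧ (∀ o, ∀ x ∈ N o, π o x = x) ∧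
      (∀ o p, o ≠ p → ∀ x ∈ N p, π o x = 0) ∧ ∀ x, ∑ o, π o x = x := by
  let D : DirectSum κ (fun o ↦ N o) ≃ₗ[K] V := LinearEquiv.ofBijective (DirectSum.coeLinearMap N) h
  have hD : ∀ o (x : N o), D.symm (x : V) = DirectSum.lof K κ (fun o ↦ N o) o x := fun o x ↦ by
    rw [LinearEquiv.symm_apply_eq]
    exact (DirectSum.coeLinearMap_lof N o x).symm
  refine ⟨fun o ↦ (N o).subtype ∘ₗ DirectSum.component K κ (fun o ↦ N o) o ∘ₗ D.symm.toLinearMap,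
    fun o x ↦ Subtype.property _, fun o x hx ↦ ?_, fun o p hop x hx ↦ ?_, fun x ↦ ?_⟩
  · have := hD o ⟨x, hx⟩
    simp only [LinearMap.comp_apply, LinearEquiv.coe_coe] at this ⊢
    rw [this, DirectSum.component.lof_self]
    rfl
  · have := hD p ⟨x, hx⟩
    simp only [LinearMap.comp_apply, LinearEquiv.coe_coe] at this ⊢
    rw [this, DirectSum.component.of, dif_neg hop.symm]
    rfl
  · classical
    obtain ⟨d, rfl⟩ := D.surjective x
    refine Eq.trans ?_ (DirectSum.coeLinearMap_eq_dfinsuppSum N d).symm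
    rw [DFinsupp.sum_eq_sum_fintype _ fun _ ↦ rfl]
    simp [DirectSum.component]
    rfl

variable {L : Type*} [LieRing L] [LieAlgebra K L] {I : κ → LieIdeal K L} {π : κ → L →ₗ[K] L}

theorem lie_eq_zero_of_projections (hπ : ∀ o, ∀ x ∈ I o, π o x = x)
    (hπ' : ∀ o p, o ≠ p → ∀ x ∈ I p, π o x = 0) {o p : κ} (hop : o ≠ p) {x y : L}
    (hx : x ∈ I o) (hy : y ∈ I p) : ⁅x, y⁆ = 0 := by
  have h1 : ⁅x, y⁆ ∈ I o := lie_mem_left K L (I o) x y hx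
  have h2 : ⁅x, y⁆ ∈ I p := lie_mem_right K L (I p) x y hy
  rw [← hπ o _ h1, hπ' o p hop _ h2]

theorem projection_lie [Fintype κ] (hmem : ∀ o x, π o x ∈ I o)
    (hπ : ∀ o, ∀ x ∈ I o, π o x = x) (hπ' : ∀ o p, o ≠ p → ∀ x ∈ I p, π o x = 0)
    (hsum : ∀ x, ∑ o, π o x = x) (o : κ) (x y : L) :
    π o ⁅x, y⁆ = ⁅π o x, π o y⁆ := by
  have h1 : ⁅x, y⁆ = ∑ p, ⁅π p x, π p y⁆ := by
    conv_lhs => rw [← hsum x, ← hsum y]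
    rw [sum_lie]
    refine Finset.sum_congr rfl fun p _ ↦ ?_
    rw [lie_sum]
    exact Finset.sum_eq_single_of_mem p (Finset.mem_univ p) fun q _ hq ↦
      lie_eq_zero_of_projections hπ hπ' hq.symm (hmem p x) (hmem q y)
  rw [h1, map_sum, Finset.sum_eq_single_of_mem o (Finset.mem_univ o)]
  · exact hπ o _ (lie_mem_left K L (I o) _ _ (hmem o x))
  · exact fun p _ hp ↦ hπ' o p hp.symm _ (lie_mem_left K L (I p) _ _ (hmem p x))

end InternalDirectSum

theorem LieAlgebra.IsSimple.eq_zero_of_forall_lie_eq_zero {L : Type*} [LieRing L]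
    [LieAlgebra ℂ L] [LieAlgebra.IsSimple ℂ L] {x : L} (hx : ∀ y : L, ⁅y, x⁆ = 0) : x = 0 := by
  have hmem : x ∈ LieAlgebra.center ℂ L := (LieModule.mem_maxTrivSubmodule ℂ L L x).mpr hx
  rcases LieAlgebra.IsSimple.eq_bot_or_eq_top (R := ℂ) (LieAlgebra.center ℂ L) with h | h
  · rwa [h, LieSubmodule.mem_bot] at hmem
  · exact absurd ((LieAlgebra.isLieAbelian_iff_center_eq_top ℂ L).mpr h)
      (LieAlgebra.IsSimple.non_abelian ℂ)

section Reductive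

variable {g : Type*} [LieRing g] [LieAlgebra ℂ g] [FiniteDimensional ℂ g] {ℓ k : ℕ}
  {s : Fin ℓ → LieIdeal ℂ g}

/-- The center is embedded in ℂ^ℓ × ℂ^m: the first ℓ coordinates act as scalars on the blocks of the
simple ideals, the rest by commuting operators on one extra block. -/
theorem IsReductiveDecomposition.mem_faithfulRepDims (hs : IsReductiveDecomposition g s)
    (hk : finrank ℂ (LieAlgebra.center ℂ g) = k) :
    ∑ i, lieMu ℂ (s i) + muComplexPow ((k : ℤ) - (ℓ : ℤ)) ∈ faithfulRepDims ℂ g := by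
  obtain ⟨hsimple, hint⟩ := hs
  obtain ⟨π, hmem, hπ, hπ', hsum⟩ := hint.exists_projections
  have hlie := projection_lie (I := fun o : Option (Fin ℓ) ↦ o.elim (LieAlgebra.center ℂ g) s)
    hmem hπ hπ' hsum
  have hnon : ∀ i, (faithfulRepDims ℂ (s i)).Nonempty := fun i ↦
    LieAlgebra.IsSimple.faithfulRepDims_nonempty
  choose ρ hρ using fun i ↦ lieMu_mem_faithfulRepDims (hnon i)
  have htwo : ∀ i, 2 ≤ lieMu ℂ (s i) := fun i ↦
    two_le_lieMu (LieAlgebra.IsSimple.non_abelian ℂ) (hnon i)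
  set m := ((k : ℤ) - (ℓ : ℤ)).toNat with hm
  obtain ⟨τ, hτ, hτcomm⟩ := exists_injective_commuting
    ((muComplexPow_le_iff ((k : ℤ) - (ℓ : ℤ)) _).mp le_rfl)
  -- Truncation of k - ℓ at zero is harmless: k ≤ ℓ + m holds in either case.
  obtain ⟨c, hc⟩ := (finrank_le_iff_exists_linearMap (R := ℂ) (M := LieAlgebra.center ℂ g)
    (M' := (Fin ℓ → ℂ) × (Fin m → ℂ))).mp (by
      simp only [finrank_prod, finrank_fin_fun, hk]
      omega)
  let q : ∀ i, g →ₗ[ℂ] s i := fun i ↦ (π (some i)).codRestrict (s i).toSubmodule (hmem (some i))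
  let ζ : g →ₗ[ℂ] (Fin ℓ → ℂ) × (Fin m → ℂ) :=
    c ∘ₗ (π none).codRestrict (LieAlgebra.center ℂ g).toSubmodule (hmem none)
  have hq : ∀ i x y, q i ⁅x, y⁆ = ⁅q i x, q i y⁆ := fun i x y ↦
    Subtype.ext (hlie (some i) x y)
  have hζ : ∀ x y : g, ζ ⁅x, y⁆ = 0 := fun x y ↦ by
    have h0 : π none ⁅x, y⁆ = 0 := by
      rw [hlie]
      exact (LieModule.mem_maxTrivSubmodule ℂ g g _).mp (hmem none y) _
    have h1 : (π none).codRestrict (LieAlgebra.center ℂ g).toSubmodule (hmem none) ⁅x, y⁆ = 0 :=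
      Subtype.ext h0
    exact (congrArg c h1).trans (map_zero c)
  let W := (∀ i, Fin (lieMu ℂ (s i)) → ℂ) × (Fin (muComplexPow ((k : ℤ) - (ℓ : ℤ))) → ℂ)
  let Φ : g → Module.End ℂ W := fun x ↦ LinearMap.prodMap
    (LinearMap.pi fun i ↦ (ρ i (q i x) + (ζ x).1 i • LinearMap.id) ∘ₗ LinearMap.proj i)
    (τ (ζ x).2)
  have hΦ1 : ∀ x (w : W) i, (Φ x w).1 i = ρ i (q i x) (w.1 i) + (ζ x).1 i • w.1 i :=
    fun _ _ _ ↦ rfl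
  have hΦ2 : ∀ x (w : W), (Φ x w).2 = τ (ζ x).2 w.2 := fun _ _ ↦ rfl
  let φ : g →ₗ⁅ℂ⁆ Module.End ℂ W :=
    { toFun := Φ
      map_add' := fun x y ↦ by
        refine LinearMap.ext fun w ↦ Prod.ext (funext fun i ↦ ?_) ?_
        · rw [LinearMap.add_apply, Prod.fst_add, Pi.add_apply, hΦ1, hΦ1, hΦ1, map_add, map_add,
            map_add, LinearMap.add_apply, Prod.fst_add, Pi.add_apply, add_smul, add_add_add_comm]
        · rw [LinearMap.add_apply, Prod.snd_add, hΦ2, hΦ2, hΦ2, map_add, Prod.snd_add, map_add,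
            LinearMap.add_apply]
      map_smul' := fun a x ↦ by
        refine LinearMap.ext fun w ↦ Prod.ext (funext fun i ↦ ?_) ?_
        · rw [RingHom.id_apply, LinearMap.smul_apply, Prod.smul_fst, Pi.smul_apply, hΦ1, hΦ1,
            map_smul, map_smul, map_smul, LinearMap.smul_apply, Prod.smul_fst, Pi.smul_apply,
            smul_add, smul_assoc]
        · rw [RingHom.id_apply, LinearMap.smul_apply, Prod.smul_snd, hΦ2, hΦ2, map_smul,
            Prod.smul_snd, map_smul, LinearMap.smul_apply]
      map_lie' := fun {x y} ↦ by
        rw [LieRing.of_associative_ring_bracket]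
        refine LinearMap.ext fun w ↦ Prod.ext (funext fun i ↦ ?_) ?_
        · change (Φ ⁅x, y⁆ w).1 i = (Φ x (Φ y w)).1 i - (Φ y (Φ x w)).1 i
          simp only [hΦ1, hq, hζ, LieHom.map_lie, LieRing.of_associative_ring_bracket, map_add,
            map_smul, LinearMap.sub_apply, Module.End.mul_apply, Prod.fst_zero, Pi.zero_apply,
            zero_smul, smul_add, smul_smul, mul_comm ((ζ x).1 i)]
          abel
        · change (Φ ⁅x, y⁆ w).2 = (Φ x (Φ y w)).2 - (Φ y (Φ x w)).2
          have := LinearMap.congr_fun (hτcomm (ζ x).2 (ζ y).2) w.2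
          rw [Module.End.mul_apply, Module.End.mul_apply] at this
          rw [hΦ2, hΦ2, hΦ2, hΦ2, hΦ2, hζ, Prod.snd_zero, map_zero, LinearMap.zero_apply, this,
            sub_self] }
  have hφ : Function.Injective φ := by
    rw [injective_iff_map_eq_zero]
    intro x hx
    have hx' : ∀ w, Φ x w = 0 := fun w ↦ LinearMap.congr_fun hx w
    have h1 : ∀ i (v : Fin (lieMu ℂ (s i)) → ℂ), ρ i (q i x) v + (ζ x).1 i • v = 0 := fun i v ↦ by
      have := congrFun (congrArg Prod.fst (hx' (Pi.single i v, 0))) i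
      rw [hΦ1] at this
      simpa using this
    -- The simple component acts on its block as a scalar, hence is central in a simple algebra.
    have h2 : ∀ i, q i x = 0 := fun i ↦
      LieAlgebra.IsSimple.eq_zero_of_forall_lie_eq_zero fun y ↦ by
        apply hρ i
        refine LinearMap.ext fun v ↦ ?_
        rw [LieHom.map_lie, map_zero, LieRing.of_associative_ring_bracket]
        have h3 : ∀ v, ρ i (q i x) v = -((ζ x).1 i • v) := fun v ↦
          eq_neg_of_add_eq_zero_left (h1 i v)
        simp [h3]
    have h4 : (ζ x).1 = 0 := funext fun i ↦ by
      have h5 := congrFun (h1 i (fun _ ↦ 1)) ⟨0, by have := htwo i; omega⟩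
      rw [h2 i, map_zero] at h5
      simpa using h5
    have h6 : (ζ x).2 = 0 := by
      apply hτ
      refine LinearMap.ext fun v ↦ ?_
      have := congrArg Prod.snd (hx' (0, v))
      rw [hΦ2] at this
      simpa using this
    have h7 : (π none).codRestrict (LieAlgebra.center ℂ g).toSubmodule (hmem none) x = 0 := by
      apply hc
      rw [map_zero]
      exact Prod.ext h4 h6
    rw [← hsum x]
    refine Finset.sum_eq_zero fun o _ ↦ ?_
    cases o with
    | none => exact congrArg Subtype.val h7
    | some i => exact congrArg Subtype.val (h2 i)
  have := finrank_mem_faithfulRepDims φ hφ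
  rwa [finrank_prod, finrank_pi_fintype, finrank_fin_fun,
    Finset.sum_congr rfl fun i _ ↦ finrank_fin_fun (n := lieMu ℂ (s i)) ℂ] at this

/-- Over the centralizer R of the image of the center, the simple ideals map into R and the center
into End_R(V). Faithfulness forces every ideal into the set A, so the bound reads k ≤ ℓ + M(b), that
is μ(ℂ^(k-ℓ)) ≤ b. -/
theorem IsReductiveDecomposition.le_finrank (hs : IsReductiveDecomposition g s)
    (hk : finrank ℂ (LieAlgebra.center ℂ g) = k) {V : Type} [AddCommGroup V] [Module ℂ V]
    [FiniteDimensional ℂ V] (φ : g →ₗ⁅ℂ⁆ Module.End ℂ V) (hφ : Function.Injective φ) :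
    ∑ i, lieMu ℂ (s i) + muComplexPow ((k : ℤ) - (ℓ : ℤ)) ≤ finrank ℂ V := by
  obtain ⟨hsimple, hint⟩ := hs
  obtain ⟨π, hmem, hπ, hπ', hsum⟩ := hint.exists_projections
  have hcomm : ∀ x y, ⁅x, y⁆ = 0 → φ x * φ y = φ y * φ x := fun x y h ↦ by
    have := congrArg φ h
    rwa [LieHom.map_lie, map_zero, LieRing.of_associative_ring_bracket, sub_eq_zero] at this
  have hcenter : ∀ x (z : LieAlgebra.center ℂ g), ⁅x, (z : g)⁆ = 0 := fun x z ↦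
    (LieModule.mem_maxTrivSubmodule ℂ g g _).mp z.2 x
  let R := Subalgebra.centralizer ℂ (Set.range fun z : LieAlgebra.center ℂ g ↦ φ z)
  have hR : ∀ x, φ x ∈ R := fun x ↦ by
    rw [Subalgebra.mem_centralizer_iff]
    rintro _ ⟨z, rfl⟩
    exact (hcomm _ _ (hcenter x z)).symm
  let f : ∀ i, s i →ₗ⁅ℂ⁆ R := fun i ↦
    { toFun := fun x ↦ ⟨φ x, hR x⟩
      map_add' := fun x y ↦ Subtype.ext (map_add φ (x : g) y)
      map_smul' := fun a x ↦ Subtype.ext (map_smul φ a (x : g))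
      map_lie' := fun {x y} ↦ Subtype.ext (LieHom.map_lie φ (x : g) y) }
  let θ : LieAlgebra.center ℂ g →ₗ[ℂ] Module.End R V :=
    { toFun := fun z ↦
        { toFun := φ z
          map_add' := map_add _
          map_smul' := fun r v ↦
            LinearMap.congr_fun ((Subalgebra.mem_centralizer_iff ℂ).mp r.2 _ ⟨z, rfl⟩) v }
      map_add' := fun x y ↦ LinearMap.ext fun v ↦ LinearMap.congr_fun (map_add φ (x : g) y) v
      map_smul' := fun a x ↦ LinearMap.ext fun v ↦ LinearMap.congr_fun (map_smul φ a (x : g)) v }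
  have hθ : Function.Injective θ := fun x y hxy ↦ Subtype.ext (hφ (LinearMap.ext fun v ↦
    LinearMap.congr_fun hxy v))
  obtain ⟨A, hA, z, hz, b, hb, hzb⟩ := exists_commutingBound f (fun i j hij x y ↦
      Subtype.ext (hcomm x y (lie_eq_zero_of_projections
        (I := fun o : Option (Fin ℓ) ↦ o.elim (LieAlgebra.center ℂ g) s) hπ hπ'
        (o := some i) (p := some j) (by simpa using hij) x.2 y.2)))
    (fun i ↦ two_le_lieMu (LieAlgebra.IsSimple.non_abelian ℂ)
      LieAlgebra.IsSimple.faithfulRepDims_nonempty) _ (LinearMap.range θ) (by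
      rintro _ ⟨x, rfl⟩ _ ⟨y, rfl⟩
      exact LinearMap.ext fun v ↦ LinearMap.congr_fun (hcomm _ _ (hcenter x y)) v) rfl
  have hAuniv : A = Finset.univ := by
    refine Finset.eq_univ_of_forall fun i ↦ by_contra fun hi ↦ ?_
    refine LieAlgebra.IsSimple.non_abelian ℂ (L := s i) ⟨fun x y ↦ Subtype.ext (hφ ?_)⟩
    exact LinearMap.ext fun v ↦ (hA i hi ⁅x, y⁆ v).trans (by simp)
  rw [LinearMap.finrank_range_of_inj hθ, hk] at hz
  rw [hAuniv, Finset.card_univ, Fintype.card_fin] at hzb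
  rw [hAuniv] at hb
  rw [hb]
  refine Nat.add_le_add_left ((muComplexPow_le_iff _ _).mpr ?_) _
  omega

end Reductive

end

theorem theorem1p4 :
    (∀ (g : Type*) [LieRing g] [LieAlgebra ℂ g] [FiniteDimensional ℂ g]
        (ℓ k : ℕ) (s : Fin ℓ → LieIdeal ℂ g),
        IsReductiveDecomposition g s →
        Module.finrank ℂ (LieAlgebra.center ℂ g) = k →
        (faithfulRepDims ℂ g).Nonempty ∧
          lieMu ℂ g = ∑ i, lieMu ℂ (s i) + muComplexPow ((k : ℤ) - (ℓ : ℤ))) ∧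
      (∀ m : ℤ, 1 < m → (muComplexPow m : ℤ) = ⌈2 * √((m : ℝ) - 1)⌉) ∧
      muComplexPow 1 = 1 ∧
      (∀ m : ℤ, m ≤ 0 → muComplexPow m = 0) := by
  refine ⟨fun g _ _ _ ℓ k s hs hk ↦ ?_, fun m hm ↦ muComplexPow_eq_ceil hm, muComplexPow_one,
    fun m hm ↦ muComplexPow_of_nonpos hm⟩
  have hmem := hs.mem_faithfulRepDims hk
  obtain ⟨φ, hφ⟩ := lieMu_mem_faithfulRepDims ⟨_, hmem⟩
  exact ⟨⟨_, hmem⟩, le_antisymm (Nat.sInf_le hmem) (by simpa using hs.le_finrank hk φ hφ)⟩
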